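/- For a finite ordered graph $\mathcal{G}$ (a graph with a total order on its vertex set), let $\mathrm{OR}(\mathcal{G})$ be the minimum integer $N$ such that every coloring of the edges of the complete graph on the vertex set $\{1,\dots,N\}$, ordered naturally, with two colors admits a strictly increasing map $V(\mathcal{G})\to\{1,\dots,N\}$ sending all edges of $\mathcal{G}$ to edges of one and the same color. For a positive integer $n$ and a permutation $\pi$ of $[n]=\{1,\dots,n\}$, let $\mathcal{M}(\pi)$ be the ordered matching with the naturally ordered vertex set $[2n]$ and edges $\{i,n+\pi(i)\}$, $i\in[n]$. Theorem. There is a constant $C>0$ such that, if $\pi$ is chosen uniformly at random from the $n!$ permutations of $[n]$, then \[\Pr\left[\mathrm{OR}(\mathcal{M}(\pi)) \ge C\left(\frac{n}{\log_2 n}\right)^2\right]\longrightarrow 1 \quad\text{as } n\to\infty.\] -/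

import Mathlib

open Filter Topology

namespace OrderedRamsey

/-- An ordered graph is a `SimpleGraph V` on a linearly ordered vertex type `V`.
`HasMonoCopy G N c` says that the 2-colouring `c` of the edges of the ordered complete graph on
`N` vertices contains a monochromatic copy of `G`: for some colour `b`, some strictly
order-preserving map `f` sends every edge of `G` to an edge of colour `b`. -/
def HasMonoCopy {V : Type*} [LinearOrder V] (G : SimpleGraph V) (N : ℕ)
    (c : SimpleGraph.TopEdgeLabeling (Fin N) Bool) : Prop :=
  ∃ (b : Bool) (f : V ↪o Fin N), ∀ u v : V, G.Adj u v → (c.labelGraph b).Adj (f u) (f v)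

/-- The ordered Ramsey number: the least `N` such that every 2-colouring of the edges of the
ordered complete graph on `N` vertices contains a monochromatic copy of `G`.
(For finite `V` such an `N` exists and the minimum is attained, see `OR_mem`.) -/
noncomputable def OR {V : Type*} [LinearOrder V] (G : SimpleGraph V) : ℕ :=
  sInf {N : ℕ | ∀ c : SimpleGraph.TopEdgeLabeling (Fin N) Bool, HasMonoCopy G N c}

/-- The ordered matching `M(π)` on `2n` linearly ordered vertices (numbered from `0`): the `i`-th
vertex of the first half is joined to the `π i`-th vertex of the second half. -/
def matching {n : ℕ} (π : Equiv.Perm (Fin n)) : SimpleGraph (Fin (n + n)) :=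
  SimpleGraph.fromEdgeSet (Set.range fun i : Fin n => s(Fin.castAdd n i, Fin.natAdd n (π i)))

/-- The probability that a uniformly random permutation of an `n`-element set lies in `A`. -/
noncomputable def permProb (n : ℕ) (A : Set (Equiv.Perm (Fin n))) : ENNReal :=
  (PMF.uniformOfFintype (Equiv.Perm (Fin n))).toOuterMeasure A

/-- The random ordered `n`-matching asymptotically almost surely satisfies `P`: the probability
that the ordered matching `M(π)` satisfies `P n`, for a uniformly random permutation `π`, tends
to `1` as `n` tends to infinity. -/
def RandomMatchingAAS (P : (n : ℕ) → SimpleGraph (Fin (n + n)) → Prop) : Prop :=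
  Tendsto (fun n : ℕ => permProb n {π | P n (matching π)}) atTop (𝓝 1)

/-! Finiteness of ordered Ramsey numbers, so that the minimum in `OR` is a genuine one. -/

theorem ramsey_finset (a b : ℕ) : ∃ N : ℕ, ∀ (R : ℕ → ℕ → Prop) (S : Finset ℕ), N ≤ S.card →
    (∃ T ⊆ S, T.card = a ∧ ∀ x ∈ T, ∀ y ∈ T, x < y → R x y) ∨
    (∃ T ⊆ S, T.card = b ∧ ∀ x ∈ T, ∀ y ∈ T, x < y → ¬ R x y) := by
  classical
  induction a generalizing b with
  | zero => exact ⟨0, fun R S _ => Or.inl ⟨∅, by simp⟩⟩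
  | succ a iha =>
    induction b with
    | zero => exact ⟨0, fun R S _ => Or.inr ⟨∅, by simp⟩⟩
    | succ b ihb =>
      obtain ⟨N₁, h₁⟩ := iha (b + 1)
      obtain ⟨N₂, h₂⟩ := ihb
      refine ⟨N₁ + N₂ + 1, fun R S hS => ?_⟩
      have hne : S.Nonempty := Finset.card_pos.mp (by omega)
      set m := S.min' hne
      have hm : m ∈ S := S.min'_mem hne
      have hlt : ∀ x ∈ S.erase m, m < x := fun x hx =>
        lt_of_le_of_ne (S.min'_le x (Finset.mem_of_mem_erase hx)) (Finset.ne_of_mem_erase hx).symm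
      have hcard := Finset.card_filter_add_card_filter_not (s := S.erase m) (fun x => R m x)
      rw [Finset.card_erase_of_mem hm] at hcard
      have key : ∀ (Q : ℕ → ℕ → Prop) (k : ℕ) (T : Finset ℕ),
          T ⊆ (S.erase m).filter (fun x => Q m x) → T.card = k →
          (∀ x ∈ T, ∀ y ∈ T, x < y → Q x y) →
          ∃ T' ⊆ S, T'.card = k + 1 ∧ ∀ x ∈ T', ∀ y ∈ T', x < y → Q x y := by
        intro Q k T hT hk hQ
        have hT1 : ∀ x ∈ T, x ∈ S.erase m ∧ Q m x := fun x hx => by simpa using hT hx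
        refine ⟨insert m T, ?_, ?_, ?_⟩
        · intro x hx
          rcases Finset.mem_insert.mp hx with rfl | hx
          · exact hm
          · exact Finset.mem_of_mem_erase (hT1 x hx).1
        · rw [Finset.card_insert_of_notMem, hk]
          intro h
          exact lt_irrefl _ (hlt m (hT1 m h).1)
        · intro x hx y hy hxy
          rcases Finset.mem_insert.mp hx with hx | hx <;>
            rcases Finset.mem_insert.mp hy with hy | hy
          · omega
          · rw [hx]; exact (hT1 y hy).2
          · have := hlt x (hT1 x hx).1
            omega
          · exact hQ x hx y hy hxy
      have hsub : ∀ (Q : ℕ → Prop) [DecidablePred Q] (T : Finset ℕ),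
          T ⊆ (S.erase m).filter Q → T ⊆ S := fun Q _ T hT =>
        hT.trans ((Finset.filter_subset _ _).trans (Finset.erase_subset _ _))
      by_cases hc : N₁ ≤ ((S.erase m).filter (fun x => R m x)).card
      · rcases h₁ R _ hc with ⟨T, hT, hk, hR⟩ | ⟨T, hT, hk, hR⟩
        · exact Or.inl (key R a T hT hk hR)
        · exact Or.inr ⟨T, hsub _ T hT, hk, hR⟩
      · rcases h₂ R ((S.erase m).filter (fun x => ¬ R m x)) (by omega) with
          ⟨T, hT, hk, hR⟩ | ⟨T, hT, hk, hR⟩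
        · exact Or.inl ⟨T, hsub _ T hT, hk, hR⟩
        · exact Or.inr (key (fun x y => ¬ R x y) b T (by convert hT) hk hR)

theorem exists_forall_hasMonoCopy {V : Type*} [LinearOrder V] [Finite V] (G : SimpleGraph V) :
    ∃ N : ℕ, ∀ c : SimpleGraph.TopEdgeLabeling (Fin N) Bool, HasMonoCopy G N c := by
  classical
  have := Fintype.ofFinite V
  obtain ⟨N, hN⟩ := ramsey_finset (Fintype.card V) (Fintype.card V)
  refine ⟨N, fun c => ?_⟩
  have main : ∀ (b : Bool) (T : Finset ℕ), T ⊆ Finset.range N → T.card = Fintype.card V →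
      (∀ x ∈ T, ∀ y ∈ T, x < y → ∀ (hx : x < N) (hy : y < N),
        (c.labelGraph b).Adj ⟨x, hx⟩ ⟨y, hy⟩) → HasMonoCopy G N c := by
    intro b T hT hk hc
    let e : V ≃o Fin (Fintype.card V) := (Fintype.orderIsoFinOfCardEq V rfl).symm
    let g : Fin (Fintype.card V) ↪o ℕ := T.orderEmbOfFin hk
    have hg : ∀ i, g i ∈ T := fun i => T.orderEmbOfFin_mem hk i
    have hgN : ∀ i, g i < N := fun i => Finset.mem_range.mp (hT (hg i))
    let f : V ↪o Fin N := OrderEmbedding.ofStrictMono (fun v => ⟨g (e v), hgN _⟩)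
      (fun u v h => g.strictMono (e.strictMono h))
    refine ⟨b, f, fun u v huv => ?_⟩
    rcases lt_or_gt_of_ne huv.ne with h | h
    · exact hc _ (hg (e u)) _ (hg (e v)) (g.strictMono (e.strictMono h)) _ _
    · exact (hc _ (hg (e v)) _ (hg (e u)) (g.strictMono (e.strictMono h)) _ _).symm
  rcases hN (fun x y => ∃ (hx : x < N) (hy : y < N),
      (c.labelGraph true).Adj ⟨x, hx⟩ ⟨y, hy⟩) (Finset.range N) (by simp) with
    ⟨T, hT, hk, hR⟩ | ⟨T, hT, hk, hR⟩
  · refine main true T hT hk fun x hx y hy hxy h1 h2 => ?_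
    obtain ⟨_, _, h⟩ := hR x hx y hy hxy
    exact h
  · refine main false T hT hk fun x hx y hy hxy h1 h2 => ?_
    have hne : (⟨x, h1⟩ : Fin N) ≠ ⟨y, h2⟩ := by
      intro h; simp only [Fin.mk.injEq] at h; omega
    have h := hR x hx y hy hxy
    simp only [SimpleGraph.EdgeLabeling.labelGraph_adj, SimpleGraph.top_adj] at h ⊢
    refine ⟨hne, ?_⟩
    by_contra h'
    exact h ⟨h1, h2, hne, by simpa using h'⟩

theorem OR_mem {V : Type*} [LinearOrder V] [Finite V] (G : SimpleGraph V) :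
    ∀ c : SimpleGraph.TopEdgeLabeling (Fin (OR G)) Bool, HasMonoCopy G (OR G) c :=
  Nat.sInf_mem (exists_forall_hasMonoCopy G)

end OrderedRamsey

namespace OrderedRamsey
open Finset

/-! Take m of order n / log n, cut at most m² vertices into m blocks of length at most m, and give
each edge a random colour `χ` of its ordered pair of blocks. In a monochromatic copy of M(π), the
blocks cut each half of the matching into intervals. Dropping those with fewer than t (of order log
n) points leaves block configurations P and Q between which all edges have one colour
(`exists_isMonoOn_of_OR_le`).

For fixed P and Q, reveal π at t points of each interval of P. Given the past, a point fails to
produce a new pair of blocks with probability at most 1/4; each new pair must receive the right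
colour, which costs 1/2. Hence the probability is at most (3/4)^(t #P) (`sum_card_isMonoOn_le`), and
passing to π⁻¹ gives the same with Q. Both together give u^#P u^#Q with u = n⁻⁵, which beats the m
n² choices for each labelled interval, so the union bound tends to 0
(`card_forall_exists_isMonoOn_le`). Pairs (π, χ) are counted: a bad π is bad for every χ, so it
contributes all colourings. -/

/-! ### Sequential exposure of a random permutation -/

/-- Switching: replace the value at j by any y not used on the rest of T. Values on T other than at
j survive, so the conditions on B persist. Conversely the result σ and the old value π j determine
π, and π j lies in `F j π = F j σ`, which leaves at most D choices. -/
theorem card_perm_mul_le {α : Type*} [Fintype α] [LinearOrder α] (T : Finset α)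
    (F : α → Equiv.Perm α → Finset α)
    (hF : ∀ x π π', (∀ y ∈ T, y < x → π y = π' y) → F x π = F x π')
    {D : ℕ} (hD : ∀ x π, #(F x π) ≤ D) (j : α) (B : Finset α) (hB : insert j B ⊆ T)
    (hj : ∀ x ∈ B, x < j) :
    #{π : Equiv.Perm α | ∀ x ∈ insert j B, π x ∈ F x π} * (Fintype.card α - #T) ≤
      #{π : Equiv.Perm α | ∀ x ∈ B, π x ∈ F x π} * D := by
  classical
  have hjT : j ∈ T := hB (mem_insert_self _ _)
  refine card_mul_le_card_mul
    (fun π π' : Equiv.Perm α => ∃ y, y ∉ (T.erase j).image π ∧ π' = Equiv.swap (π j) y * π) ?_ ?_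
  · intro π hπ
    simp only [mem_filter, mem_univ, true_and] at hπ
    have hinj : Function.Injective (fun y => Equiv.swap (π j) y * π) := by
      intro y z h
      simpa using congrArg (fun σ : Equiv.Perm α => σ j) h
    calc Fintype.card α - #T ≤ #((T.erase j).image π)ᶜ := by
          rw [card_compl]
          have := card_image_le (s := T.erase j) (f := π)
          have := card_erase_le (s := T) (a := j)
          omega
      _ = #(((T.erase j).image π)ᶜ.image (fun y => Equiv.swap (π j) y * π)) :=
          (card_image_of_injective _ hinj).symm
      _ ≤ _ := by
          refine card_le_card fun σ hσ => ?_
          obtain ⟨y, hy, rfl⟩ := mem_image.mp hσ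
          rw [mem_compl] at hy
          have hfix : ∀ x ∈ T, x ≠ j → (Equiv.swap (π j) y * π) x = π x := by
            intro x hx hxj
            rw [Equiv.Perm.mul_apply, Equiv.swap_apply_of_ne_of_ne]
            · exact fun h => hxj (π.injective h)
            · rintro rfl
              exact hy (mem_image_of_mem _ (mem_erase.mpr ⟨hxj, hx⟩))
          simp only [mem_bipartiteAbove, mem_filter, mem_univ, true_and]
          refine ⟨fun x hx => ?_, y, hy, rfl⟩
          have hxj := hj x hx
          rw [hfix x (hB (mem_insert_of_mem hx)) hxj.ne,
            hF x _ π fun z hz hzx => hfix z hz (hzx.trans hxj).ne]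
          exact hπ x (mem_insert_of_mem hx)
  · intro σ _
    calc _ ≤ #((F j σ).image (fun z => Equiv.swap z (σ j) * σ)) := by
          refine card_le_card fun π hπ => ?_
          simp only [mem_bipartiteBelow, mem_filter, mem_univ, true_and] at hπ
          obtain ⟨hπ, y, hy, rfl⟩ := hπ
          have hfix : ∀ x ∈ T, x < j → π x = (Equiv.swap (π j) y * π) x := by
            intro x hx hxj
            rw [Equiv.Perm.mul_apply, Equiv.swap_apply_of_ne_of_ne]
            · exact fun h => hxj.ne (π.injective h)
            · rintro rfl
              exact hy (mem_image_of_mem _ (mem_erase.mpr ⟨hxj.ne, hx⟩))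
          rw [← hF j π _ hfix]
          refine mem_image.mpr ⟨π j, hπ j (mem_insert_self _ _), ?_⟩
          rw [Equiv.Perm.mul_apply, Equiv.swap_apply_left, ← mul_assoc, Equiv.swap_mul_self,
            one_mul]
      _ ≤ _ := card_image_le.trans (hD j σ)

/-- Removing the largest point of B costs a factor δ by switching, as if the events were
independent. -/
theorem card_perm_forall_mem_le {α : Type*} [Fintype α] [LinearOrder α] (T : Finset α)
    (F : α → Equiv.Perm α → Finset α)
    (hF : ∀ x π π', (∀ y ∈ T, y < x → π y = π' y) → F x π = F x π')
    {D : ℕ} (hD : ∀ x π, #(F x π) ≤ D) (hT : #T < Fintype.card α) {δ : ℝ} (hδ0 : 0 ≤ δ)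
    (hδ : (D : ℝ) ≤ δ * (Fintype.card α - #T : ℕ)) (B : Finset α) (hB : B ⊆ T) :
    (#{π : Equiv.Perm α | ∀ x ∈ B, π x ∈ F x π} : ℝ) ≤
      δ ^ #B * Fintype.card (Equiv.Perm α) := by
  classical
  induction B using Finset.induction_on_max with
  | empty => simp
  | insert j B hj ih =>
    have h1 := card_perm_mul_le T F hF hD j B hB hj
    have ih := ih ((subset_insert _ _).trans hB)
    have hr : (0 : ℝ) < (Fintype.card α - #T : ℕ) := by
      exact_mod_cast Nat.sub_pos_of_lt hT
    have h1' : (#{π : Equiv.Perm α | ∀ x ∈ insert j B, π x ∈ F x π} : ℝ) *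
        (Fintype.card α - #T : ℕ) ≤ #{π : Equiv.Perm α | ∀ x ∈ B, π x ∈ F x π} * D := by
      exact_mod_cast h1
    rw [card_insert_of_notMem fun h => (hj j h).false]
    refine le_of_mul_le_mul_right (h1'.trans ?_) hr
    calc _ ≤ (δ ^ #B * Fintype.card (Equiv.Perm α)) * (δ * (Fintype.card α - #T : ℕ)) := by
          gcongr
      _ = _ := by ring

/-- The weight of π is one term, B the full set of hits, of a sum over all sets B of hits; after
exchanging sums, the binomial theorem applies. -/
theorem sum_perm_pow_le {α : Type*} [Fintype α] [LinearOrder α] (T : Finset α)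
    (F : α → Equiv.Perm α → Finset α)
    (hF : ∀ x π π', (∀ y ∈ T, y < x → π y = π' y) → F x π = F x π')
    {D : ℕ} (hD : ∀ x π, #(F x π) ≤ D) (hT : #T < Fintype.card α) {δ : ℝ} (hδ0 : 0 ≤ δ)
    (hδ : (D : ℝ) ≤ δ * (Fintype.card α - #T : ℕ)) {w : ℝ} (hw : 0 ≤ w) :
    ∑ π : Equiv.Perm α, w ^ (#T - #{x ∈ T | π x ∈ F x π}) ≤
      (δ + w) ^ #T * Fintype.card (Equiv.Perm α) := by
  classical
  calc ∑ π : Equiv.Perm α, w ^ (#T - #{x ∈ T | π x ∈ F x π})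
      ≤ ∑ π : Equiv.Perm α, ∑ B ∈ T.powerset,
          if (∀ x ∈ B, π x ∈ F x π) then w ^ (#T - #B) else 0 := by
        refine sum_le_sum fun π _ => ?_
        refine le_trans (le_of_eq ?_) (single_le_sum (f := fun B : Finset α =>
          if (∀ x ∈ B, π x ∈ F x π) then w ^ (#T - #B) else 0) (fun B _ => ?_)
          (mem_powerset.mpr (filter_subset (fun x => π x ∈ F x π) T)))
        · rw [if_pos fun x hx => (mem_filter.mp hx).2]
        · split_ifs <;> positivity
    _ = ∑ B ∈ T.powerset, (#{π : Equiv.Perm α | ∀ x ∈ B, π x ∈ F x π} : ℝ) * w ^ (#T - #B) := by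
        rw [sum_comm]
        refine sum_congr rfl fun B _ => ?_
        rw [← sum_filter, sum_const, nsmul_eq_mul]
    _ ≤ ∑ B ∈ T.powerset, (δ ^ #B * Fintype.card (Equiv.Perm α)) * w ^ (#T - #B) := by
        refine sum_le_sum fun B hB => ?_
        gcongr
        exact card_perm_forall_mem_le T F hF hD hT hδ0 hδ B (mem_powerset.mp hB)
    _ = (∑ B ∈ T.powerset, δ ^ #B * w ^ (#T - #B)) * Fintype.card (Equiv.Perm α) := by
        rw [sum_mul]
        exact sum_congr rfl fun B _ => by ring
    _ = _ := by rw [sum_pow_mul_eq_add_pow]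

/-! ### Monochromatic colourings for a fixed pair of block configurations -/

theorem card_colouring_const_on {β : Type*} [Fintype β] [DecidableEq β] (H : Finset β)
    (c : Bool) :
    (#{χ : β → Bool | ∀ z ∈ H, χ z = c} : ℝ) = (1 / 2) ^ #H * 2 ^ Fintype.card β := by
  have h : ({χ : β → Bool | ∀ z ∈ H, χ z = c} : Finset (β → Bool)) =
      Fintype.piFinset fun z => if z ∈ H then {c} else univ := by
    ext χ
    simp only [mem_filter, mem_univ, true_and, Fintype.mem_piFinset]
    refine forall_congr' fun z => ?_
    split_ifs with hz <;> simp [hz]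
  have h2 : ∀ z, #(if z ∈ H then {c} else (univ : Finset Bool)) = if z ∈ H then 1 else 2 := by
    intro z
    split_ifs <;> simp
  rw [h, Fintype.card_piFinset]
  simp only [h2]
  rw [prod_ite, prod_const_one, one_mul, prod_const, ← card_add_card_compl H, pow_add]
  have h3 : ({x | x ∉ H} : Finset β) = Hᶜ := by ext; simp
  rw [h3]
  push_cast
  rw [← mul_assoc, ← mul_pow]
  norm_num

/-- A block configuration: a family of labelled, pairwise disjoint intervals `Icc e.2.1 e.2.2`
of `Fin n` with distinct labels in `Fin m`, of lengths between `t` and `m`, which together miss at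
most `m * t` points. -/
structure IsBlockConfig (m n t : ℕ) (P : Finset (Fin m × Fin n × Fin n)) : Prop where
  injOn : ∀ e ∈ P, ∀ f ∈ P, e.1 = f.1 → e = f
  disjoint : ∀ e ∈ P, ∀ f ∈ P, ∀ x ∈ Icc e.2.1 e.2.2, x ∈ Icc f.2.1 f.2.2 → e = f
  le_card : ∀ e ∈ P, t ≤ #(Icc e.2.1 e.2.2)
  card_le : ∀ e ∈ P, #(Icc e.2.1 e.2.2) ≤ m
  cover : #{x : Fin n | ∀ e ∈ P, x ∉ Icc e.2.1 e.2.2} ≤ m * t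

/-- Every edge of `M(π)` between an interval of `P` and an interval of `Q` receives colour `c`
in the block colouring `χ`. -/
def IsMonoOn {m n : ℕ} (P Q : Finset (Fin m × Fin n × Fin n)) (c : Bool)
    (π : Equiv.Perm (Fin n)) (χ : Fin m × Fin m → Bool) : Prop :=
  ∀ e ∈ P, ∀ f ∈ Q, ∀ x ∈ Icc e.2.1 e.2.2, π x ∈ Icc f.2.1 f.2.2 → χ (e.1, f.1) = c

noncomputable instance (m n t : ℕ) : DecidablePred (IsBlockConfig m n t) :=
  Classical.decPred _

noncomputable instance {m n : ℕ} (P Q : Finset (Fin m × Fin n × Fin n)) (c : Bool)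
    (π : Equiv.Perm (Fin n)) : DecidablePred (IsMonoOn P Q c π) :=
  Classical.decPred _

/-- The values of `π x` which do not give a new pair of blocks: those outside the intervals of
`Q`, and those in an interval of `Q` already met by an earlier point of the block of `x`. -/
def repeatedValues {m n : ℕ} (P Q : Finset (Fin m × Fin n × Fin n))
    (T : Fin m × Fin n × Fin n → Finset (Fin n)) (x : Fin n) (π : Equiv.Perm (Fin n)) :
    Finset (Fin n) :=
  (univ.filter fun z => ∀ f ∈ Q, z ∉ Icc f.2.1 f.2.2) ∪
    {e ∈ P | x ∈ T e}.biUnion fun e => {y ∈ T e | y < x}.biUnion fun y =>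
      {f ∈ Q | π y ∈ Icc f.2.1 f.2.2}.biUnion fun f => Icc f.2.1 f.2.2

/-- At most m t values are uncovered by Q, and each of at most t earlier points of the same block
spoils one interval of at most m values. -/
theorem card_repeatedValues_le {m n t : ℕ} {P Q : Finset (Fin m × Fin n × Fin n)}
    (hP : IsBlockConfig m n t P) (hQ : IsBlockConfig m n t Q)
    {T : Fin m × Fin n × Fin n → Finset (Fin n)} (hT : ∀ e ∈ P, T e ⊆ Icc e.2.1 e.2.2)
    (hTc : ∀ e ∈ P, #(T e) = t) (x : Fin n) (π : Equiv.Perm (Fin n)) :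
    #(repeatedValues P Q T x π) ≤ 2 * (m * t) := by
  refine (card_union_le _ _).trans ?_
  rw [two_mul]
  refine add_le_add hQ.cover ?_
  have h1 : #{e ∈ P | x ∈ T e} ≤ 1 := card_le_one.mpr fun e he f hf => by
    rw [mem_filter] at he hf
    exact hP.disjoint e he.1 f hf.1 x (hT e he.1 he.2) (hT f hf.1 hf.2)
  have h2 : ∀ y, #{f ∈ Q | π y ∈ Icc f.2.1 f.2.2} ≤ 1 := fun y =>
    card_le_one.mpr fun e he f hf => by
      rw [mem_filter] at he hf
      exact hQ.disjoint e he.1 f hf.1 _ he.2 hf.2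
  have h3 : ∀ y, #({f ∈ Q | π y ∈ Icc f.2.1 f.2.2}.biUnion fun f => Icc f.2.1 f.2.2) ≤ m :=
    fun y => (card_biUnion_le_card_mul _ _ m fun f hf =>
      hQ.card_le f (mem_filter.mp hf).1).trans
        ((Nat.mul_le_mul_right _ (h2 y)).trans (one_mul m).le)
  refine (card_biUnion_le_card_mul _ _ (t * m) fun e he => ?_).trans
    ((Nat.mul_le_mul_right _ h1).trans (by rw [one_mul, mul_comm]))
  refine (card_biUnion_le_card_mul _ _ m fun y _ => h3 y).trans ?_
  exact Nat.mul_le_mul_right _ ((card_filter_le _ _).trans (hTc e (mem_filter.mp he).1).le)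

theorem repeatedValues_congr {m n : ℕ} (P Q : Finset (Fin m × Fin n × Fin n))
    (T : Fin m × Fin n × Fin n → Finset (Fin n)) (x : Fin n) (π π' : Equiv.Perm (Fin n))
    (h : ∀ y ∈ P.biUnion T, y < x → π y = π' y) :
    repeatedValues P Q T x π = repeatedValues P Q T x π' := by
  unfold repeatedValues
  congr 1
  refine biUnion_congr rfl fun e he => biUnion_congr rfl fun y hy => ?_
  rw [mem_filter] at he hy
  rw [h y (mem_biUnion.mpr ⟨e, he.1, hy.1⟩) hy.2]

/-- Points with non-repeated values give distinct pairs of labels, hence independent coordinates of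
χ, all forced to equal c. -/
theorem card_isMonoOn_le {m n t : ℕ} {P Q : Finset (Fin m × Fin n × Fin n)}
    (hP : IsBlockConfig m n t P) (hQ : IsBlockConfig m n t Q)
    {T : Fin m × Fin n × Fin n → Finset (Fin n)} (hT : ∀ e ∈ P, T e ⊆ Icc e.2.1 e.2.2)
    (c : Bool) (π : Equiv.Perm (Fin n)) :
    (#{χ | IsMonoOn P Q c π χ} : ℝ) ≤
      (1 / 2) ^ (#(P.biUnion T) - #{x ∈ P.biUnion T | π x ∈ repeatedValues P Q T x π}) *
        2 ^ Fintype.card (Fin m × Fin m) := by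
  -- The later `choose!` needs a default value in this type.
  rcases isEmpty_or_nonempty (Fin m × Fin n × Fin n) with hα | hα
  · rw [Subsingleton.elim P ∅, biUnion_empty, filter_empty, card_empty, pow_zero, one_mul]
    norm_cast
    exact (card_le_univ _).trans (by rw [Fintype.card_fun, Fintype.card_bool])
  set S := {x ∈ P.biUnion T | π x ∉ repeatedValues P Q T x π} with hS
  have hcard : #(P.biUnion T) - #{x ∈ P.biUnion T | π x ∈ repeatedValues P Q T x π} = #S := by
    have h := card_filter_add_card_filter_not (s := P.biUnion T)
      (fun x => π x ∈ repeatedValues P Q T x π)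
    rw [← h, Nat.add_sub_cancel_left]
  have hex : ∀ x ∈ S, ∃ e f, (e ∈ P ∧ x ∈ T e) ∧ f ∈ Q ∧ π x ∈ Icc f.2.1 f.2.2 := by
    intro x hx
    obtain ⟨hx1, hx2⟩ := mem_filter.mp hx
    obtain ⟨e, he⟩ := mem_biUnion.mp hx1
    rw [repeatedValues, mem_union, not_or, mem_filter] at hx2
    have := hx2.1
    push Not at this
    obtain ⟨f, hf⟩ := this (mem_univ _)
    exact ⟨e, f, he, hf⟩
  choose! p q hp hq using hex
  have hnew : ∀ x ∈ S, ∀ y ∈ S, y < x → (p x).1 = (p y).1 → (q x).1 ≠ (q y).1 := by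
    intro x hx y hy hyx hpe hqe
    have hpe := hP.injOn _ (hp x hx).1 _ (hp y hy).1 hpe
    have hqe := hQ.injOn _ (hq x hx).1 _ (hq y hy).1 hqe
    refine (mem_filter.mp hx).2 (mem_union_right _ ?_)
    simp only [mem_biUnion, mem_filter]
    exact ⟨p x, hp x hx, y, ⟨hpe ▸ (hp y hy).2, hyx⟩, q y, hq y hy, hqe ▸ (hq x hx).2⟩
  have hinj : Set.InjOn (fun x => ((p x).1, (q x).1)) (S : Set (Fin n)) := by
    intro x hx y hy hxy
    rw [Prod.mk.injEq] at hxy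
    rcases lt_trichotomy x y with h | h | h
    · exact absurd hxy.2.symm (hnew y hy x hx h hxy.1.symm)
    · exact h
    · exact absurd hxy.2 (hnew x hx y hy h hxy.1)
  rw [hcard, ← card_image_of_injOn hinj, ← card_colouring_const_on _ c]
  norm_cast
  refine card_le_card fun χ hχ => ?_
  rw [mem_filter] at hχ ⊢
  refine ⟨mem_univ _, fun z hz => ?_⟩
  obtain ⟨x, hx, rfl⟩ := mem_image.mp hz
  exact hχ.2 _ (hp x hx).1 _ (hq x hx).1 x (hT _ (hp x hx).1 (hp x hx).2) (hq x hx).2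

theorem sum_card_isMonoOn_le {m n t : ℕ} (hn : 0 < n) (hmt : 9 * (m * t) ≤ n)
    {P Q : Finset (Fin m × Fin n × Fin n)}
    (hP : IsBlockConfig m n t P) (hQ : IsBlockConfig m n t Q) (c : Bool) :
    ∑ π : Equiv.Perm (Fin n), (#{χ | IsMonoOn P Q c π χ} : ℝ) ≤
      (3 / 4) ^ (#P * t) * Fintype.card (Equiv.Perm (Fin n)) *
        2 ^ Fintype.card (Fin m × Fin m) := by
  have hex : ∀ e ∈ P, ∃ T ⊆ Icc e.2.1 e.2.2, #T = t := fun e he =>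
    exists_subset_card_eq (hP.le_card e he)
  choose! T hT hTc using hex
  have hTcard : #(P.biUnion T) = #P * t := by
    rw [card_biUnion, sum_const_nat hTc]
    intro e he f hf hef
    refine disjoint_left.mpr fun x hx hx' => hef ?_
    exact hP.disjoint e he f hf x (hT e he hx) (hT f hf hx')
  have hPm : #P ≤ m := by
    have := card_le_card_of_injOn (s := P) (t := (univ : Finset (Fin m))) Prod.fst
      (fun _ _ => mem_univ _) (fun e he f hf h => hP.injOn e he f hf h)
    simpa using this
  have hTm : #(P.biUnion T) ≤ m * t := hTcard ▸ Nat.mul_le_mul_right t hPm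
  calc ∑ π : Equiv.Perm (Fin n), (#{χ | IsMonoOn P Q c π χ} : ℝ)
      ≤ ∑ π : Equiv.Perm (Fin n), (1 / 2 : ℝ) ^ (#(P.biUnion T) -
          #{x ∈ P.biUnion T | π x ∈ repeatedValues P Q T x π}) *
            2 ^ Fintype.card (Fin m × Fin m) :=
        sum_le_sum fun π _ => card_isMonoOn_le hP hQ hT c π
    _ ≤ (1 / 4 + 1 / 2) ^ #(P.biUnion T) * Fintype.card (Equiv.Perm (Fin n)) *
          2 ^ Fintype.card (Fin m × Fin m) := by
        rw [← sum_mul]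
        refine mul_le_mul_of_nonneg_right ?_ (by positivity)
        refine le_trans (le_of_eq ?_) (sum_perm_pow_le (P.biUnion T) (repeatedValues P Q T)
          (repeatedValues_congr P Q T) (card_repeatedValues_le hP hQ hT hTc) ?_
          (by norm_num : (0 : ℝ) ≤ 1 / 4) ?_ (by norm_num : (0 : ℝ) ≤ 1 / 2))
        · congr!
        · rw [Fintype.card_fin]; omega
        · rw [Fintype.card_fin]
          -- This is where δ = 1/4 comes from: at most 2 m t repeated values against at least 8 m t
          -- unused ones.
          have : 8 * (m * t) ≤ n - #(P.biUnion T) := by omega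
          have : (8 * (m * t) : ℝ) ≤ (n - #(P.biUnion T) : ℕ) := by exact_mod_cast this
          push_cast
          linarith
    _ = _ := by rw [hTcard]; norm_num

/-- The estimate of `sum_card_isMonoOn_le` in terms of the larger of the two families. -/
theorem sum_card_isMonoOn_le_sq {m n t : ℕ} (hn : 0 < n) (hmt : 9 * (m * t) ≤ n)
    {P Q : Finset (Fin m × Fin n × Fin n)}
    (hP : IsBlockConfig m n t P) (hQ : IsBlockConfig m n t Q) (c : Bool)
    {u : ℝ} (hu0 : 0 ≤ u) (hu1 : u ≤ 1) (hu : (3 / 4 : ℝ) ^ t ≤ u ^ 2) :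
    ∑ π : Equiv.Perm (Fin n), (#{χ | IsMonoOn P Q c π χ} : ℝ) ≤
      u ^ #P * u ^ #Q * Fintype.card (Equiv.Perm (Fin n)) *
        2 ^ Fintype.card (Fin m × Fin m) := by
  have key : ∀ a b : ℕ, a ≤ b → (3 / 4 : ℝ) ^ (b * t) ≤ u ^ a * u ^ b := by
    intro a b hab
    calc (3 / 4 : ℝ) ^ (b * t) = ((3 / 4 : ℝ) ^ t) ^ b := by rw [mul_comm, pow_mul]
      _ ≤ (u ^ 2) ^ b := by gcongr
      _ = u ^ b * u ^ b := by rw [← pow_mul, ← pow_add]; congr 1; ring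
      _ ≤ u ^ a * u ^ b := by
          refine mul_le_mul_of_nonneg_right (pow_le_pow_of_le_one hu0 hu1 hab) (by positivity)
  rcases le_total #Q #P with h | h
  · refine (sum_card_isMonoOn_le hn hmt hP hQ c).trans ?_
    gcongr
    rw [mul_comm (u ^ _)]
    exact key _ _ h
  · have hflip : ∑ π : Equiv.Perm (Fin n), (#{χ | IsMonoOn P Q c π χ} : ℝ) =
        ∑ π : Equiv.Perm (Fin n), (#{χ | IsMonoOn Q P c π χ} : ℝ) := by
      -- Inverting π and transposing χ exchanges the two halves of the matching.
      rw [← Equiv.sum_comp (Equiv.inv (Equiv.Perm (Fin n)))]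
      refine sum_congr rfl fun π _ => ?_
      norm_cast
      refine card_equiv (Equiv.arrowCongr (Equiv.prodComm (Fin m) (Fin m)) (Equiv.refl Bool))
        fun χ => ?_
      rw [mem_filter, mem_filter]
      simp only [mem_univ, true_and, IsMonoOn, Equiv.inv_apply]
      constructor
      · intro H e he f hf x hx hxf
        exact H f hf e he (π x) hxf (by simpa using hx)
      · intro H e he f hf x hx hxf
        exact H f hf e he (π⁻¹ x) hxf (by simpa using hx)
    rw [hflip]
    refine (sum_card_isMonoOn_le hn hmt hQ hP c).trans ?_
    gcongr
    exact key _ _ h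

/-! ### Union bound over block configurations -/

theorem sum_sum_mul_mul_eq {ι : Type*} (s : Finset ι) (g : ι → ℝ) (K M : ℝ) :
    ∑ i ∈ s, ∑ j ∈ s, ∑ _c : Bool, g i * g j * K * M = 2 * (∑ i ∈ s, g i) ^ 2 * K * M := by
  have h : ∀ i j, ∑ _c : Bool, g i * g j * K * M = g i * (g j * (2 * K * M)) := fun i j => by
    rw [Fintype.sum_bool]; ring
  simp_rw [h, ← mul_sum, ← sum_mul]
  ring

/-- The union bound over all pairs of block configurations. -/
theorem card_forall_exists_isMonoOn_le {m n t : ℕ} (hn : 0 < n) (hmt : 9 * (m * t) ≤ n)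
    {u : ℝ} (hu0 : 0 ≤ u) (hu1 : u ≤ 1) (hu : (3 / 4 : ℝ) ^ t ≤ u ^ 2)
    {A : Finset (Equiv.Perm (Fin n))}
    (hA : ∀ π ∈ A, ∀ χ, ∃ P Q c, IsBlockConfig m n t P ∧ IsBlockConfig m n t Q ∧
      IsMonoOn P Q c π χ) :
    (#A : ℝ) ≤ 2 * ((1 + u) ^ (m * (n * n)) - 1) ^ 2 * Fintype.card (Equiv.Perm (Fin n)) := by
  obtain ⟨𝒞, h𝒞⟩ : ∃ 𝒞 : Finset (Finset (Fin m × Fin n × Fin n)),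
      ∀ P, P ∈ 𝒞 ↔ IsBlockConfig m n t P :=
    ⟨univ.filter (IsBlockConfig m n t), fun P => by rw [mem_filter]; simp⟩
  -- Excluding the empty family removes the term 1 from the binomial sum; otherwise the bound could
  -- not tend to 0.
  have hne : ∀ P ∈ 𝒞, P ≠ ∅ := by
    rintro P hP rfl
    have := ((h𝒞 _).mp hP).cover
    simp at this
    omega
  have hsum : ∑ P ∈ 𝒞, u ^ #P ≤ (1 + u) ^ (m * (n * n)) - 1 := by
    have h1 : ∑ P ∈ 𝒞, u ^ #P ≤ ∑ P ∈ univ.erase ∅, u ^ #P :=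
      sum_le_sum_of_subset_of_nonneg
        (fun P hP => mem_erase.mpr ⟨hne P hP, mem_univ _⟩) (fun _ _ _ => by positivity)
    have h2 := Fintype.sum_pow_mul_eq_add_pow (Fin m × Fin n × Fin n) u 1
    rw [← add_sum_erase _ _ (mem_univ ∅)] at h2
    simp only [one_pow, mul_one, card_empty, pow_zero, Fintype.card_prod, Fintype.card_fin] at h2
    rw [add_comm 1 u]
    linarith
  have hpos : (0 : ℝ) < 2 ^ Fintype.card (Fin m × Fin m) := by positivity
  refine le_of_mul_le_mul_right ?_ hpos
  calc (#A : ℝ) * 2 ^ Fintype.card (Fin m × Fin m)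
      = ∑ π ∈ A, (#(univ : Finset (Fin m × Fin m → Bool)) : ℝ) := by
        rw [sum_const, nsmul_eq_mul, card_univ, Fintype.card_fun]
        simp
    _ ≤ ∑ π ∈ A, ∑ P ∈ 𝒞, ∑ Q ∈ 𝒞, ∑ c : Bool, (#{χ | IsMonoOn P Q c π χ} : ℝ) := by
        refine sum_le_sum fun π hπ => ?_
        norm_cast
        calc _ ≤ #(𝒞.biUnion fun P => 𝒞.biUnion fun Q => univ.biUnion fun c : Bool =>
                ({χ | IsMonoOn P Q c π χ} : Finset (Fin m × Fin m → Bool))) := by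
              refine card_le_card fun χ _ => ?_
              obtain ⟨P, Q, c, hP, hQ, h⟩ := hA π hπ χ
              exact mem_biUnion.mpr ⟨P, (h𝒞 P).mpr hP, mem_biUnion.mpr ⟨Q, (h𝒞 Q).mpr hQ,
                mem_biUnion.mpr ⟨c, mem_univ c, mem_filter.mpr ⟨mem_univ χ, h⟩⟩⟩⟩
          _ ≤ _ := card_biUnion_le.trans (sum_le_sum fun P _ =>
              card_biUnion_le.trans (sum_le_sum fun Q _ => card_biUnion_le))
    _ ≤ ∑ π : Equiv.Perm (Fin n), ∑ P ∈ 𝒞, ∑ Q ∈ 𝒞, ∑ c : Bool,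
          (#{χ | IsMonoOn P Q c π χ} : ℝ) :=
        sum_le_sum_of_subset_of_nonneg (subset_univ _) fun _ _ _ =>
          sum_nonneg fun _ _ => sum_nonneg fun _ _ => sum_nonneg fun _ _ => Nat.cast_nonneg _
    _ = ∑ P ∈ 𝒞, ∑ Q ∈ 𝒞, ∑ c : Bool, ∑ π : Equiv.Perm (Fin n),
          (#{χ | IsMonoOn P Q c π χ} : ℝ) := by
        rw [sum_comm]
        refine sum_congr rfl fun P _ => ?_
        rw [sum_comm]
        refine sum_congr rfl fun Q _ => ?_
        rw [sum_comm]
    _ ≤ ∑ P ∈ 𝒞, ∑ Q ∈ 𝒞, ∑ c : Bool, u ^ #P * u ^ #Q *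
          Fintype.card (Equiv.Perm (Fin n)) * 2 ^ Fintype.card (Fin m × Fin m) := by
        refine sum_le_sum fun P hP => sum_le_sum fun Q hQ => sum_le_sum fun c _ => ?_
        exact sum_card_isMonoOn_le_sq hn hmt ((h𝒞 P).mp hP) ((h𝒞 Q).mp hQ) c hu0 hu1 hu
    _ = 2 * (∑ P ∈ 𝒞, u ^ #P) ^ 2 * Fintype.card (Equiv.Perm (Fin n)) *
          2 ^ Fintype.card (Fin m × Fin m) :=
        sum_sum_mul_mul_eq 𝒞 (fun P => u ^ #P) _ _
    _ ≤ _ := by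
        have : 0 ≤ ∑ P ∈ 𝒞, u ^ #P := sum_nonneg fun _ _ => by positivity
        gcongr

/-! ### From monochromatic copies to block configurations -/

/-- Fibres of a monotone map are intervals. Keep those with at least t points, recorded by label,
minimum and maximum; the discarded ones are at most m in number, with fewer than t points each. -/
theorem exists_isBlockConfig {m n : ℕ} (t : ℕ) {L : Fin n → Fin m} (hL : Monotone L)
    (hm : ∀ a, #{x | L x = a} ≤ m) :
    ∃ P, IsBlockConfig m n t P ∧ ∀ e ∈ P, ∀ x ∈ Icc e.2.1 e.2.2, L x = e.1 := by
  set P : Finset (Fin m × Fin n × Fin n) := {e | t ≤ #{x | L x = e.1} ∧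
    (∀ x, L x = e.1 → e.2.1 ≤ x ∧ x ≤ e.2.2) ∧ L e.2.1 = e.1 ∧ L e.2.2 = e.1} with hP
  have hmem : ∀ e, e ∈ P ↔ t ≤ #{x | L x = e.1} ∧
      (∀ x, L x = e.1 → e.2.1 ≤ x ∧ x ≤ e.2.2) ∧ L e.2.1 = e.1 ∧ L e.2.2 = e.1 := fun e => by
    rw [hP, mem_filter]; simp
  have hIcc : ∀ e ∈ P, Icc e.2.1 e.2.2 = ({x | L x = e.1} : Finset (Fin n)) := by
    intro e he
    obtain ⟨-, h1, h2, h3⟩ := (hmem e).mp he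
    ext x
    simp only [mem_Icc, mem_filter, mem_univ, true_and]
    exact ⟨fun hx => le_antisymm ((hL hx.2).trans h3.le) (h2.ge.trans (hL hx.1)), h1 x⟩
  have hval : ∀ e ∈ P, ∀ x ∈ Icc e.2.1 e.2.2, L x = e.1 := by
    intro e he x hx
    rw [hIcc e he] at hx
    exact (mem_filter.mp hx).2
  have hinj : ∀ e ∈ P, ∀ f ∈ P, e.1 = f.1 → e = f := by
    intro e he f hf hef
    obtain ⟨-, h1, h2, h3⟩ := (hmem e).mp he
    obtain ⟨-, g1, g2, g3⟩ := (hmem f).mp hf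
    refine Prod.ext hef (Prod.ext ?_ ?_)
    · exact le_antisymm (h1 _ (g2.trans hef.symm)).1 (g1 _ (h2.trans hef)).1
    · exact le_antisymm (g1 _ (h3.trans hef)).2 (h1 _ (g3.trans hef.symm)).2
  refine ⟨P, ⟨hinj, ?_, ?_, ?_, ?_⟩, hval⟩
  · intro e he f hf x hx hx'
    exact hinj e he f hf ((hval e he x hx).symm.trans (hval f hf x hx'))
  · intro e he
    rw [hIcc e he]
    exact ((hmem e).mp he).1
  · intro e he
    rw [hIcc e he]
    exact hm _
  · have hsub : ({x | ∀ e ∈ P, x ∉ Icc e.2.1 e.2.2} : Finset (Fin n)) ⊆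
        ({a | #{x | L x = a} < t} : Finset (Fin m)).biUnion fun a => {x | L x = a} := by
      intro x hx
      rw [mem_filter] at hx
      simp only [mem_biUnion, mem_filter, mem_univ, true_and]
      refine ⟨L x, ?_, rfl⟩
      by_contra! hlt
      have hne : ({y | L y = L x} : Finset (Fin n)).Nonempty := ⟨x, by simp⟩
      have hmin := min'_mem _ hne
      have hmax := max'_mem _ hne
      rw [mem_filter] at hmin hmax
      have he : (L x, min' _ hne, max' _ hne) ∈ P := (hmem _).mpr ⟨hlt, fun y hy =>
        ⟨min'_le _ _ (by simpa using hy), le_max' _ _ (by simpa using hy)⟩, hmin.2, hmax.2⟩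
      refine hx.2 _ he (mem_Icc.mpr ⟨min'_le _ _ (by simp), le_max' _ _ (by simp)⟩)
    refine (card_le_card hsub).trans ((card_biUnion_le_card_mul _ _ t fun a ha =>
      (mem_filter.mp ha).2.le).trans (Nat.mul_le_mul_right _ ?_))
    exact (card_le_univ _).trans (Fintype.card_fin m).le

/-- The partition of `Fin N` into at most `m` consecutive blocks of length `m`. -/
def blockIndex {m N : ℕ} (hN : N ≤ m * m) (x : Fin N) : Fin m :=
  ⟨x / m, Nat.div_lt_of_lt_mul (x.2.trans_le hN)⟩

theorem blockIndex_mono {m N : ℕ} (hN : N ≤ m * m) : Monotone (blockIndex hN) :=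
  fun _ _ h => Nat.div_le_div_right (c := m) h

theorem card_blockIndex_fiber_le {m n N : ℕ} (hN : N ≤ m * m) {f : Fin n → Fin N}
    (hf : Function.Injective f) (a : Fin m) : #{x | blockIndex hN (f x) = a} ≤ m := by
  have hm : 0 < m := a.pos
  have h := card_le_card_of_injOn (s := ({x | blockIndex hN (f x) = a} : Finset (Fin n)))
    (t := Finset.Ico (m * a) (m * a + m)) (fun x => (f x : ℕ)) ?_ ?_
  · simpa using h
  · intro x hx
    have hx : (f x : ℕ) / m = a := congrArg Fin.val (by simpa using hx)
    have h1 := Nat.div_add_mod (f x : ℕ) m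
    have h2 := Nat.mod_lt (f x : ℕ) hm
    rw [hx] at h1
    simp only [coe_Ico, Set.mem_Ico]
    omega
  · intro x _ y _ h
    exact hf (Fin.ext h)

/-- The edge colouring in which the colour of an edge depends only on the blocks of its ends. -/
def blockColouring {m N : ℕ} (hN : N ≤ m * m) (χ : Fin m × Fin m → Bool) :
    SimpleGraph.TopEdgeLabeling (Fin N) Bool :=
  SimpleGraph.EdgeLabeling.mk
    (fun x y _ => χ (blockIndex hN (min x y), blockIndex hN (max x y)))
    (fun x y _ => by rw [min_comm, max_comm])

theorem exists_isMonoOn_of_OR_le {m n : ℕ} (t : ℕ) {π : Equiv.Perm (Fin n)}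
    (hN : OR (matching π) ≤ m * m) (χ : Fin m × Fin m → Bool) :
    ∃ P Q c, IsBlockConfig m n t P ∧ IsBlockConfig m n t Q ∧ IsMonoOn P Q c π χ := by
  obtain ⟨c, f, hf⟩ := OR_mem (matching π) (blockColouring hN χ)
  have hl : StrictMono fun x : Fin n => f (Fin.castAdd n x) :=
    f.strictMono.comp (Fin.strictMono_castAdd n)
  have hr : StrictMono fun x : Fin n => f (Fin.natAdd n x) :=
    f.strictMono.comp (Fin.strictMono_natAdd n)
  obtain ⟨P, hP, hPv⟩ := exists_isBlockConfig t ((blockIndex_mono hN).comp hl.monotone)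
    (card_blockIndex_fiber_le hN hl.injective)
  obtain ⟨Q, hQ, hQv⟩ := exists_isBlockConfig t ((blockIndex_mono hN).comp hr.monotone)
    (card_blockIndex_fiber_le hN hr.injective)
  refine ⟨P, Q, c, hP, hQ, fun e he q hq x hx hx' => ?_⟩
  have hlt : Fin.castAdd n x < Fin.natAdd n (π x) := by
    rw [Fin.lt_def, Fin.val_castAdd, Fin.val_natAdd]
    omega
  have hadj : (matching π).Adj (Fin.castAdd n x) (Fin.natAdd n (π x)) := by
    rw [matching, SimpleGraph.fromEdgeSet_adj]
    exact ⟨⟨x, rfl⟩, hlt.ne⟩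
  have hcol := hf _ _ hadj
  rw [SimpleGraph.TopEdgeLabeling.labelGraph_adj] at hcol
  obtain ⟨hne, hcol⟩ := hcol
  rw [blockColouring, SimpleGraph.EdgeLabeling.get_mk, min_eq_left (f.monotone hlt.le),
    max_eq_right (f.monotone hlt.le)] at hcol
  rw [← hPv e he x hx, ← hQv q hq _ hx']
  exact hcol

/-! ### Choice of parameters and conclusion -/

theorem three_quarters_pow_le {n : ℕ} (hn : 0 < n) :
    (3 / 4 : ℝ) ^ (30 * (Nat.log 2 n + 1)) ≤ (((n : ℝ) ^ 5)⁻¹) ^ 2 := by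
  have h1 : (n : ℝ) ≤ 2 ^ (Nat.log 2 n + 1) := by
    exact_mod_cast (Nat.lt_pow_succ_log_self one_lt_two n).le
  have hn' : (0 : ℝ) < n := by exact_mod_cast hn
  calc (3 / 4 : ℝ) ^ (30 * (Nat.log 2 n + 1))
      = (((3 / 4 : ℝ) ^ 3) ^ (Nat.log 2 n + 1)) ^ 10 := by
        rw [← pow_mul, ← pow_mul]; congr 1; ring
    -- The factor 30 is 3 · 10: (3/4)³ < 1/2, and the exponent 10 yields u² for u = n⁻⁵.
    _ ≤ ((1 / 2 : ℝ) ^ (Nat.log 2 n + 1)) ^ 10 := by gcongr; norm_num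
    _ = ((2 ^ (Nat.log 2 n + 1))⁻¹) ^ 10 := by rw [one_div, inv_pow]
    _ ≤ ((n : ℝ)⁻¹) ^ 10 := by gcongr
    _ = _ := by rw [← inv_pow, ← pow_mul]

theorem card_OR_le_le {n m : ℕ} (hn : 0 < n) (hm : 9 * (m * (30 * (Nat.log 2 n + 1))) ≤ n)
    {A : Finset (Equiv.Perm (Fin n))} (hA : ∀ π ∈ A, OR (matching π) ≤ m * m) :
    (#A : ℝ) ≤ 8 / (n : ℝ) * Fintype.card (Equiv.Perm (Fin n)) := by
  have hn1 : (1 : ℝ) ≤ n := by exact_mod_cast hn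
  have hu1 : ((n : ℝ) ^ 5)⁻¹ ≤ 1 := inv_le_one_of_one_le₀ (one_le_pow₀ hn1)
  refine (card_forall_exists_isMonoOn_le hn hm (by positivity) hu1 (three_quarters_pow_le hn)
    fun π hπ χ => exists_isMonoOn_of_OR_le _ (hA π hπ) χ).trans ?_
  gcongr
  set u : ℝ := ((n : ℝ) ^ 5)⁻¹ with hu
  have hmn : m ≤ n := by nlinarith [Nat.zero_le (m * Nat.log 2 n)]
  have hexp : (1 + u) ^ (m * (n * n)) ≤ Real.exp ((n : ℝ)⁻¹) := by
    have hu0 : 0 ≤ u := by positivity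
    calc (1 + u) ^ (m * (n * n)) ≤ (Real.exp u) ^ (m * (n * n)) := by
          gcongr
          rw [add_comm]; exact Real.add_one_le_exp u
      _ = Real.exp ((m * (n * n) : ℕ) * u) := (Real.exp_nat_mul _ _).symm
      _ ≤ Real.exp ((n : ℝ)⁻¹) := by
          refine Real.exp_le_exp.mpr ?_
          have h3 : ((m * (n * n) : ℕ) : ℝ) ≤ (n : ℝ) ^ 4 := by
            have : m * (n * n) ≤ n * (n * n) * n :=
              (Nat.mul_le_mul_right _ hmn).trans (Nat.le_mul_of_pos_right _ hn)
            calc ((m * (n * n) : ℕ) : ℝ) ≤ ((n * (n * n) * n : ℕ) : ℝ) := by exact_mod_cast this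
              _ = _ := by push_cast; ring
          calc _ ≤ (n : ℝ) ^ 4 * u := by gcongr
            _ = _ := by rw [hu]; field_simp
  have hx1 : (n : ℝ)⁻¹ ≤ 1 := inv_le_one_of_one_le₀ hn1
  have hx0 : 0 < (n : ℝ)⁻¹ := by positivity
  have h2 := Real.abs_exp_sub_one_le (x := (n : ℝ)⁻¹) (by rwa [abs_of_pos hx0])
  rw [abs_of_pos hx0] at h2
  have h3 : (1 + u) ^ (m * (n * n)) - 1 ≤ 2 * (n : ℝ)⁻¹ := by
    linarith [le_abs_self (Real.exp ((n : ℝ)⁻¹) - 1)]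
  have h4 : 0 ≤ (1 + u) ^ (m * (n * n)) - 1 :=
    sub_nonneg.mpr (one_le_pow₀ (by linarith [show 0 ≤ u by positivity]))
  rw [div_eq_mul_inv]
  -- The bound so far is 2 (2/n)² = 8/n², weakened to 8/n.
  nlinarith

theorem mul_log_add_one_le {n : ℕ} (hn : 4096 ≤ n) : 270 * (Nat.log 2 n + 1) ≤ n := by
  have h1 : ∀ j, 12 ≤ j → 270 * (j + 1) ≤ 2 ^ j := by
    intro j hj
    induction j, hj using Nat.le_induction with
    | base => norm_num
    | succ j hj ih => rw [pow_succ]; omega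
  have h2 : 12 ≤ Nat.log 2 n := (Nat.le_log_iff_pow_le one_lt_two (by omega)).mpr (by omega)
  exact (h1 _ h2).trans (Nat.pow_log_le_self 2 (by omega))

/-- Here 270 = 9 · 30 is forced by the union bound, and 1080 = 4 · 270 pays for k ≤ 2 log₂ n and m +
1 ≤ 2m. The threshold 4096 = 2¹² guarantees m ≥ 1. -/
theorem sq_div_logb_le {n : ℕ} (hn : 4096 ≤ n) :
    (1 / 1080 : ℝ) ^ 2 * ((n : ℝ) / Real.logb 2 n) ^ 2 ≤
      ((n / (270 * (Nat.log 2 n + 1)) : ℕ) : ℝ) ^ 2 := by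
  set k := Nat.log 2 n + 1 with hk
  set m := n / (270 * k) with hm
  have hk0 : 0 < 270 * k := by positivity
  have hm1 : 1 ≤ m := (Nat.one_le_div_iff hk0).mpr (mul_log_add_one_le hn)
  have hlt : n < 270 * k * (m + 1) := Nat.lt_mul_div_succ n hk0
  have hlt' : (n : ℝ) ≤ 270 * k * (m + 1) := by exact_mod_cast hlt.le
  have hm1' : (1 : ℝ) ≤ m := by exact_mod_cast hm1
  have hlog1 : (Nat.log 2 n : ℝ) ≤ Real.logb 2 n := by exact_mod_cast Real.natLog_le_logb n 2
  have hlog2 : 1 ≤ Real.logb 2 n := by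
    rw [Real.le_logb_iff_rpow_le one_lt_two (by positivity), Real.rpow_one]
    exact_mod_cast (by omega : 2 ≤ n)
  have hk2 : (k : ℝ) ≤ 2 * Real.logb 2 n := by
    rw [hk]; push_cast; linarith
  rw [← mul_pow]
  have h0 : 0 < Real.logb 2 n := by linarith
  refine pow_le_pow_left₀ (by positivity) ?_ 2
  rw [mul_div_assoc', div_le_iff₀ h0]
  have : (k : ℝ) * (m + 1) ≤ 2 * Real.logb 2 n * (2 * m) := by
    gcongr; linarith
  nlinarith

theorem one_sub_le_permProb {n : ℕ} {S : Set (Equiv.Perm (Fin n))} {ε : ℝ}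
    (hS : ∀ A : Finset (Equiv.Perm (Fin n)), (∀ π ∈ A, π ∉ S) →
      (#A : ℝ) ≤ ε * Fintype.card (Equiv.Perm (Fin n))) :
    ENNReal.ofReal (1 - ε) ≤ permProb n S := by
  classical
  have hK : (0 : ℝ) < Fintype.card (Equiv.Perm (Fin n)) := by exact_mod_cast Fintype.card_pos
  have h1 := hS {π | π ∉ S} fun π hπ => (mem_filter.mp hπ).2
  have h2 := card_filter_add_card_filter_not (s := (univ : Finset (Equiv.Perm (Fin n))))
    (fun π => π ∈ S)
  rw [card_univ] at h2
  have h3 : (#{π | π ∈ S} : ℝ) + #{π | π ∉ S} = Fintype.card (Equiv.Perm (Fin n)) := by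
    exact_mod_cast h2
  rw [permProb, PMF.toOuterMeasure_uniformOfFintype_apply, Fintype.card_subtype,
    ← ENNReal.ofReal_natCast, ← ENNReal.ofReal_natCast, ← ENNReal.ofReal_div_of_pos hK]
  refine ENNReal.ofReal_le_ofReal ?_
  rw [le_div_iff₀ hK]
  linarith

theorem exists_randomMatchingAAS_le_OR :
    ∃ C : ℝ, 0 < C ∧
      RandomMatchingAAS fun n M =>
        C * ((n : ℝ) / Real.logb 2 (n : ℝ)) ^ 2 ≤ (OR M : ℝ) := by
  refine ⟨(1 / 1080) ^ 2, by norm_num, ?_⟩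
  have hlim : Tendsto (fun n : ℕ => ENNReal.ofReal (1 - 8 / (n : ℝ))) atTop (𝓝 1) := by
    have h := (tendsto_const_div_atTop_nhds_zero_nat (8 : ℝ)).const_sub 1
    rw [sub_zero] at h
    simpa using ENNReal.tendsto_ofReal h
  refine tendsto_of_tendsto_of_tendsto_of_le_of_le' hlim tendsto_const_nhds ?_ ?_
  · filter_upwards [eventually_ge_atTop 4096] with n hn
    refine one_sub_le_permProb fun A hA => ?_
    refine card_OR_le_le (m := n / (270 * (Nat.log 2 n + 1))) (by omega) ?_ fun π hπ => ?_
    · have := Nat.div_mul_le_self n (270 * (Nat.log 2 n + 1))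
      linarith
    · have h := hA π hπ
      simp only [Set.mem_ofPred_eq, not_le] at h
      have h' := h.trans_le (sq_div_logb_le hn)
      rw [sq] at h'
      exact_mod_cast h'.le
  · refine Eventually.of_forall fun n => ?_
    calc permProb n _ ≤ permProb n Set.univ :=
          (PMF.uniformOfFintype _).toOuterMeasure.mono (Set.subset_univ _)
      _ = 1 := by
          rw [permProb, PMF.toOuterMeasure_apply_eq_one_iff]
          exact Set.subset_univ _

end OrderedRamsey

theorem mainTheorem5 :
    ∃ C : ℝ, 0 < C ∧
      OrderedRamsey.RandomMatchingAAS fun n M =>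
        C * ((n : ℝ) / Real.logb 2 (n : ℝ)) ^ 2 ≤ (OrderedRamsey.OR M : ℝ) :=
  OrderedRamsey.exists_randomMatchingAAS_le_OR
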